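/- Let $k$ be a field and let $R=k[x_1,\dots,x_n]$ be graded by assigning to each variable $x_i$ an arbitrary weight $\deg x_i=w_i\in\mathbb{Z}_{\ge 0}$. Let $f_1,\dots,f_r\in R$ be homogeneous elements of positive degrees $d_1,\dots,d_r$ for this grading (the zero polynomial counts as homogeneous of every degree). For an ideal $I\subseteq R$ let $\operatorname{codim} I$ denote its height, i.e. the infimum of the heights of the prime ideals containing $I$. Let $\mathrm{Kos}_*(f)$ be the Koszul complex of $f=(f_1,\dots,f_r)$: the exterior algebra $\bigwedge_R(Rt_1\oplus\cdots\oplus Rt_r)$ with $t_i$ in homological degree $1$ and with the differential of degree $-1$ determined by $d(t_i)=f_i$ and the graded Leibniz rule. A sequence $g_1,\dots,g_t\in R$ is called regular if $g_i$ is a non-zero-divisor on $R/(g_1,\dots,g_{i-1})$ for $1\le i\le t$ and $(g_1,\dots,g_t)\neq R$. Then the following conditions are equivalent: 1. $f_1,\dots,f_r$ is a regular sequence; 2. $\operatorname{codim}(f_1,\dots,f_j)=j$ for all $1\le j\le r$; 3. $\operatorname{codim}(f_1,\dots,f_r)=r$; 4. $H_j(\mathrm{Kos}_*(f))=0$ for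 all $1\le j\le r$; 5. $H_1(\mathrm{Kos}_*(f))=0$. Moreover, if $f_1,\dots,f_r$ is a regular sequence, then any subsequence of it, taken in any order, is also a regular sequence: for pairwise distinct indices $i_1,\dots,i_t\in\{1,\dots,r\}$, the sequence $f_{i_1},\dots,f_{i_t}$ is regular. -/

import Mathlib

noncomputable section

namespace KoszulCx

universe u

variable {R : Type u} [CommRing R] {r : ℕ}

/-- The differential of the Koszul algebra of `f₁, …, f_r`, on the exterior algebra of the free
module `R t₁ ⊕ ⋯ ⊕ R t_r` (here `Fin r → R`, with `t_i = Pi.single i 1`): the contraction with the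
linear form `t_i ↦ f_i`. It is the odd derivation with `d t_i = f_i`; see `diff_gen`, `diff_mul`. -/
def diff (f : Fin r → R) :
    ExteriorAlgebra R (Fin r → R) →ₗ[R] ExteriorAlgebra R (Fin r → R) :=
  CliffordAlgebra.contractLeft (Fintype.linearCombination R f)

theorem diff_ι_mul (f : Fin r → R) (m : Fin r → R) (x : ExteriorAlgebra R (Fin r → R)) :
    diff f (ExteriorAlgebra.ι R m * x) =
      (Fintype.linearCombination R f m) • x - ExteriorAlgebra.ι R m * diff f x :=
  CliffordAlgebra.contractLeft_ι_mul _ _ _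

theorem diff_one (f : Fin r → R) : diff f 1 = 0 :=
  CliffordAlgebra.contractLeft_one _ (Fintype.linearCombination R f)

/-- `d t_i = f_i`. -/
theorem diff_gen (f : Fin r → R) (i : Fin r) :
    diff f (ExteriorAlgebra.ι R (Pi.single i 1)) =
      algebraMap R (ExteriorAlgebra R (Fin r → R)) (f i) := by
  have h := diff_ι_mul f (Pi.single i 1) 1
  rw [mul_one, diff_one, mul_zero, sub_zero] at h
  rw [h, Algebra.algebraMap_eq_smul_one]
  simp [Fintype.linearCombination_apply_single]

theorem diff_diff (f : Fin r → R) (x : ExteriorAlgebra R (Fin r → R)) :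
    diff f (diff f x) = 0 :=
  CliffordAlgebra.contractLeft_contractLeft _ _

theorem ext_pow_induction {P : ℕ → ExteriorAlgebra R (Fin r → R) → Prop}
    (h0 : ∀ a : R, P 0 (algebraMap R _ a))
    (hadd : ∀ j x y, P j x → P j y → P j (x + y))
    (hmul : ∀ j m x, x ∈ (⋀[R]^j (Fin r → R)) → P j x → P (j + 1) (ExteriorAlgebra.ι R m * x))
    (j : ℕ) (x : ExteriorAlgebra R (Fin r → R)) (hx : x ∈ (⋀[R]^j (Fin r → R))) : P j x := by
  induction hx using Submodule.pow_induction_on_left' with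
  | algebraMap a => exact h0 a
  | add x y i _ _ ihx ihy => exact hadd i x y ihx ihy
  | mem_mul m hm i x hx ih =>
    obtain ⟨m, rfl⟩ := hm
    exact hmul i m x hx ih

/-- The graded Leibniz rule `d (x y) = d x · y + (-1)^{deg x} x · d y`. -/
theorem diff_mul (f : Fin r → R) (j : ℕ) (x y : ExteriorAlgebra R (Fin r → R))
    (hx : x ∈ (⋀[R]^j (Fin r → R))) :
    diff f (x * y) = diff f x * y + (-1) ^ j * (x * diff f y) := by
  refine ext_pow_induction
    (P := fun j x => diff f (x * y) = diff f x * y + (-1) ^ j * (x * diff f y)) ?_ ?_ ?_ j x hx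
  · intro a
    have : diff f (algebraMap R (ExteriorAlgebra R (Fin r → R)) a) = 0 := by
      rw [Algebra.algebraMap_eq_smul_one, map_smul, diff_one, smul_zero]
    rw [this, ← Algebra.smul_def, map_smul, ← Algebra.smul_def]
    simp
  · intro j x y hx hy
    simp only [add_mul, map_add, hx, hy, mul_add]
    abel
  · intro j m x _ ih
    rw [mul_assoc, diff_ι_mul, diff_ι_mul, ih, sub_mul, smul_mul_assoc, mul_add, pow_succ]
    have hc : ExteriorAlgebra.ι R m * (-1) ^ j = (-1) ^ j * ExteriorAlgebra.ι R m :=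
      ((Commute.neg_one_right _).pow_right j).eq
    rw [← mul_assoc (ExteriorAlgebra.ι R m) ((-1) ^ j), hc]
    noncomm_ring

theorem diff_mem_aux (f : Fin r → R) (j : ℕ) (x : ExteriorAlgebra R (Fin r → R))
    (hx : x ∈ (⋀[R]^j (Fin r → R))) :
    (j = 0 → diff f x = 0) ∧ ∀ i, j = i + 1 → diff f x ∈ (⋀[R]^i (Fin r → R)) := by
  refine ext_pow_induction
    (P := fun j x => (j = 0 → diff f x = 0) ∧
      ∀ i, j = i + 1 → diff f x ∈ (⋀[R]^i (Fin r → R))) ?_ ?_ ?_ j x hx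
  · refine fun a => ⟨fun _ => ?_, fun i hi => by omega⟩
    rw [Algebra.algebraMap_eq_smul_one, map_smul, diff_one, smul_zero]
  · intro j x y hx hy
    refine ⟨fun h => ?_, fun i h => ?_⟩
    · rw [map_add, hx.1 h, hy.1 h, add_zero]
    · rw [map_add]
      exact Submodule.add_mem _ (hx.2 i h) (hy.2 i h)
  · intro j m x hx ih
    refine ⟨fun h => by omega, fun i h => ?_⟩
    obtain rfl : j = i := by omega
    rw [diff_ι_mul]
    refine Submodule.sub_mem _ (Submodule.smul_mem _ _ hx) ?_
    cases j with
    | zero => rw [ih.1 rfl, mul_zero]; exact Submodule.zero_mem _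
    | succ i =>
      have h2 := Submodule.mul_mem_mul
        (LinearMap.mem_range_self (ExteriorAlgebra.ι R (M := Fin r → R)) m) (ih.2 i rfl)
      rwa [← pow_succ'] at h2

theorem diff_mem (f : Fin r → R) (j : ℕ) (x : ExteriorAlgebra R (Fin r → R))
    (hx : x ∈ (⋀[R]^(j + 1) (Fin r → R))) : diff f x ∈ (⋀[R]^j (Fin r → R)) :=
  (diff_mem_aux f (j + 1) x hx).2 j rfl

/-- The component `⋀^{j+1} R^r → ⋀^j R^r` of the Koszul differential. -/
def diffDeg (f : Fin r → R) (j : ℕ) :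
    (⋀[R]^(j + 1) (Fin r → R)) →ₗ[R] (⋀[R]^j (Fin r → R)) :=
  (diff f).restrict (diff_mem f j)

/-- The Koszul complex `Kos_*(f)`, with `⋀^j R^r` in homological degree `j`. -/
def koszul (f : Fin r → R) : ChainComplex (ModuleCat.{u} R) ℕ :=
  ChainComplex.of (fun j => ModuleCat.of R (⋀[R]^j (Fin r → R)))
    (fun j => ModuleCat.ofHom (diffDeg f j))
    (fun j => by
      apply ModuleCat.hom_ext
      exact LinearMap.ext fun x => Subtype.ext (diff_diff f x))

end KoszulCx

end

/-! The cycle is 1 → 2 → 3 → 4 → 5 → 1. For 1 → 2, Krull's height theorem bounds the height above,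
and each new nonzerodivisor leaves the minimal primes of its predecessors, which bounds it below.

For 3 → 4, polynomial rings over a field are Cohen–Macaulay (`exists_isWeaklyRegular_of_le_height`,
by Noether normalization), so the ideal of the `f i` contains a weakly regular sequence of length
`r`. Each of its members acts null-homotopically on the Koszul complex, which has length `r`; a
depth chase then gives exactness.

For 5 → 1, vanishing of `H₁` says that all syzygies are Koszul syzygies (`OnlyTrivialSyzygies`).
This makes the last `f i` a nonzerodivisor modulo the others and, by a graded Nakayama argument,
passes to initial segments. The property ignores the order of the `f i`, whence the claim on
subsequences. -/

open RingTheory.Sequence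

universe u

/-! ### Exactness from null-homotopies -/

/-- A weakly regular sequence on `R` is weakly regular on every flat `R`-module. -/
theorem RingTheory.Sequence.IsWeaklyRegular.of_flat_module {R M : Type*} [CommRing R]
    [AddCommGroup M] [Module R M] [Module.Flat R M] {rs : List R} (h : IsWeaklyRegular R rs) :
    IsWeaklyRegular M rs :=
  ((TensorProduct.rid R M).isWeaklyRegular_congr rs).mp h.isWeaklyRegular_lTensor

theorem LinearMap.map_mem_ideal_smul_top {R M N : Type*} [CommRing R] [AddCommGroup M] [Module R M]
    [AddCommGroup N] [Module R N] (φ : M →ₗ[R] N) {I : Ideal R} {x : M}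
    (hx : x ∈ I • (⊤ : Submodule R M)) : φ x ∈ I • (⊤ : Submodule R N) := by
  have h := Submodule.mem_map_of_mem (f := φ) hx
  rw [Submodule.map_smul''] at h
  exact (smul_mono_right I le_top : I • Submodule.map φ ⊤ ≤ I • ⊤) h

/-- A complex of length `r` on which multiplication by each member of a weakly regular sequence of
length at least `r` is null-homotopic is exact in positive degrees. -/
theorem exists_eq_of_homotopy_of_isWeaklyRegular {R : Type*} [CommRing R] {L : ℕ → Type*}
    [∀ j, AddCommGroup (L j)] [∀ j, Module R (L j)] (d : ∀ j, L (j + 1) →ₗ[R] L j)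
    (hd : ∀ j x, d j (d (j + 1) x) = 0) {rs : List R} {r : ℕ} (hr : r ≤ rs.length)
    (hL : ∀ j, r < j → Subsingleton (L j))
    (hreg : ∀ j, IsWeaklyRegular (L j) rs)
    (hh : ∀ g ∈ rs, ∃ h : ∀ j, L j →ₗ[R] L (j + 1),
      ∀ j x, d (j + 1) (h (j + 1) x) + h j (d j x) = g • x)
    (i : ℕ) (x : L (i + 1)) (hx : d i x = 0) : ∃ z, d (i + 1) z = x := by
  -- Cycles modulo the first `s` elements are boundaries modulo them. Here `c` counts the remaining
  -- elements; passing from `(s, i)` to `(s + 1, i + 1)` preserves `i + 1 + c` less one step of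
  -- each, so at `c = 0` the degree exceeds `r` and the module vanishes.
  have key : ∀ c s : ℕ, c + s = rs.length → ∀ i, r < i + 1 + c → ∀ x : L (i + 1),
      d i x ∈ Ideal.ofList (rs.take s) • (⊤ : Submodule R (L i)) →
      ∃ z, x - d (i + 1) z ∈ Ideal.ofList (rs.take s) • (⊤ : Submodule R (L (i + 1))) := by
    intro c
    induction c with
    | zero =>
      intro s _ i hi x _
      have := hL (i + 1) hi
      exact ⟨0, by rw [Subsingleton.elim (x - _) 0]; exact zero_mem _⟩
    | succ c ih =>
      intro s hs i hi x hx
      have hlt : s < rs.length := by omega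
      obtain ⟨h, hh⟩ := hh rs[s] (List.getElem_mem hlt)
      have hle : Ideal.ofList (rs.take (s + 1)) =
          Ideal.ofList (rs.take s) ⊔ Ideal.span {rs[s]} := by
        rw [List.take_succ_eq_append_getElem hlt, Ideal.ofList_append, Ideal.ofList_singleton]
      -- With `g = rs[s]`, `d h x = g x - h d x` makes `h x` a cycle modulo one more element, so `h
      -- x = d z + v + g u` with `v` in the smaller submodule. Applying `d` puts `g (x - d u)` in
      -- the smaller submodule, and `g` cancels.
      have hy : d (i + 1) (h (i + 1) x) ∈
          Ideal.ofList (rs.take (s + 1)) • (⊤ : Submodule R (L (i + 1))) := by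
        rw [eq_sub_of_add_eq (hh i x), hle]
        refine sub_mem (Submodule.smul_mem_smul ?_ trivial)
          (Submodule.smul_mono_left le_sup_left ((h i).map_mem_ideal_smul_top hx))
        exact Ideal.mem_sup_right (Ideal.mem_span_singleton_self _)
      obtain ⟨z, hz⟩ := ih (s + 1) (by omega) (i + 1) (by omega) _ hy
      rw [hle, Submodule.sup_smul, Submodule.mem_sup] at hz
      obtain ⟨v, hv, u', hu', hz⟩ := hz
      rw [Submodule.ideal_span_singleton_smul] at hu'
      obtain ⟨u, -, rfl⟩ := hu'
      refine ⟨u, ?_⟩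
      refine (isSMulRegular_quotient_iff_mem_of_smul_mem _ _).mp
        ((hreg (i + 1)).regular_mod_prev s hlt) _ ?_
      have e := hh i x
      rw [← sub_add_cancel (h (i + 1) x) (d (i + 1 + 1) z), ← hz] at e
      simp only [map_add, hd, add_zero, DistribSMul.toLinearMap_apply, map_smul] at e
      rw [smul_sub, ← e, add_right_comm, add_sub_cancel_right]
      exact add_mem ((d (i + 1)).map_mem_ideal_smul_top hv) ((h i).map_mem_ideal_smul_top hx)
  obtain ⟨z, hz⟩ := key rs.length 0 (by omega) i (by omega) x (by rw [hx]; exact zero_mem _)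
  refine ⟨z, ?_⟩
  rw [List.take_zero, Ideal.ofList_nil, Submodule.bot_smul, Submodule.mem_bot, sub_eq_zero] at hz
  exact hz.symm

/-! ### Null-homotopies on the Koszul complex -/

namespace KoszulCx

variable {R : Type*} [CommRing R] {r : ℕ}

/-- Left multiplication by `m` in the exterior algebra, as a map `⋀^j → ⋀^{j+1}`. -/
noncomputable def wedgeLeft (m : Fin r → R) (j : ℕ) :
    (⋀[R]^j (Fin r → R)) →ₗ[R] (⋀[R]^(j + 1) (Fin r → R)) :=
  (LinearMap.mulLeft R (ExteriorAlgebra.ι R m)).restrict fun x hx => by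
    have h := Submodule.mul_mem_mul
      (LinearMap.mem_range_self (ExteriorAlgebra.ι R (M := Fin r → R)) m) hx
    rwa [← pow_succ'] at h

theorem diffDeg_wedgeLeft (f m : Fin r → R) (j : ℕ) (x : ⋀[R]^(j + 1) (Fin r → R)) :
    diffDeg f (j + 1) (wedgeLeft m (j + 1) x) + wedgeLeft m j (diffDeg f j x) =
      Fintype.linearCombination R f m • x := by
  refine Subtype.ext ?_
  change diff f (ExteriorAlgebra.ι R m * (x : ExteriorAlgebra R (Fin r → R))) +
    ExteriorAlgebra.ι R m * diff f x = _
  rw [diff_ι_mul, sub_add_cancel]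
  rfl

theorem diffDeg_diffDeg (f : Fin r → R) (j : ℕ) (x : ⋀[R]^(j + 1 + 1) (Fin r → R)) :
    diffDeg f j (diffDeg f (j + 1) x) = 0 :=
  Subtype.ext (diff_diff f x)

theorem subsingleton_exteriorPower_of_lt {j : ℕ} (hj : r < j) :
    Subsingleton (⋀[R]^j (Fin r → R)) := by
  have : IsEmpty (Set.powersetCard (Fin r) j) := by
    refine ⟨fun s => ?_⟩
    have h := s.1.card_le_univ
    rw [Set.powersetCard.card_eq s, Fintype.card_fin] at h
    omega
  exact ((Pi.basisFun R (Fin r)).exteriorPower j).repr.toEquiv.subsingleton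

/-- If the ideal `(f₁, …, f_r)` contains a weakly regular sequence of length at least `r`, then the
Koszul complex of `f` is exact in positive degrees. -/
theorem exists_diffDeg_eq (f : Fin r → R) {rs : List R} (hr : r ≤ rs.length)
    (hreg : IsWeaklyRegular R rs) (hmem : ∀ g ∈ rs, g ∈ Ideal.span (Set.range f))
    (i : ℕ) (x : ⋀[R]^(i + 1) (Fin r → R)) (hx : diffDeg f i x = 0) :
    ∃ z, diffDeg f (i + 1) z = x := by
  refine exists_eq_of_homotopy_of_isWeaklyRegular (diffDeg f) (diffDeg_diffDeg f) hr
    (fun j hj => subsingleton_exteriorPower_of_lt hj) (fun j => hreg.of_flat_module)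
    (fun g hg => ?_) i x hx
  obtain ⟨m, rfl⟩ := Ideal.mem_span_range_iff_exists_fun.mp (hmem g hg)
  exact ⟨wedgeLeft m, diffDeg_wedgeLeft f m⟩

theorem isZero_homology_iff {R : Type u} [CommRing R] (f : Fin r → R) (i : ℕ) :
    CategoryTheory.Limits.IsZero ((koszul f).homology (i + 1)) ↔
      ∀ x, diffDeg f i x = 0 → ∃ z, diffDeg f (i + 1) z = x := by
  rw [← HomologicalComplex.exactAt_iff_isZero_homology,
    HomologicalComplex.exactAt_iff' _ (i + 1 + 1) (i + 1) i (by simp) (by simp),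
    CategoryTheory.ShortComplex.moduleCat_exact_iff]
  have h (j : ℕ) : (koszul f).d (j + 1) j = ModuleCat.ofHom (diffDeg f j) :=
    ChainComplex.of_d (fun j => ModuleCat.of R (⋀[R]^j (Fin r → R)))
      (fun j => ModuleCat.ofHom (diffDeg f j)) j
  change (∀ x, (koszul f).d (i + 1) i x = 0 → ∃ z, (koszul f).d (i + 1 + 1) (i + 1) z = x) ↔ _
  rw [h, h]
  rfl

end KoszulCx

/-! ### Heights and regular sequences in `A[X]` -/

namespace Polynomial

/-- A nonzero prime of `D[X]` that meets the domain `D` only in zero has height at most one. -/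
theorem height_le_one_of_comap_C_eq_bot {D : Type*} [CommRing D] [IsDomain D]
    (P : Ideal D[X]) [P.IsPrime] (h : P.comap C = ⊥) : P.height ≤ 1 := by
  let K := FractionRing D
  let _ : Algebra D[X] K[X] := Polynomial.algebra D K
  have : IsLocalization (Submonoid.map C (nonZeroDivisors D)) K[X] :=
    Polynomial.isLocalization _ K
  have hdis : Disjoint (Submonoid.map C (nonZeroDivisors D) : Set D[X]) P := by
    rw [Set.disjoint_left]
    rintro _ ⟨a, ha, rfl⟩ haP
    have : a ∈ P.comap C := haP
    rw [h, Ideal.mem_bot] at this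
    exact nonZeroDivisors.ne_zero ha this
  rw [← IsLocalization.height_map_of_disjoint (S := K[X])
    (Submonoid.map C (nonZeroDivisors D)) P hdis]
  have hp := IsLocalization.isPrime_of_isPrime_disjoint (Submonoid.map C (nonZeroDivisors D)) K[X]
    P ‹_› hdis
  have hdim := Ideal.height_le_ringKrullDim_of_ne_top hp.ne_top
  rw [ringKrullDim_of_isNoetherianRing, ringKrullDim_eq_zero_of_field, zero_add] at hdim
  exact_mod_cast hdim

/-- The height of `P` is at most that of its contraction `p` plus that of its image in the fibre `(A
⧸ p)[X]`, where the image meets the base domain in zero. -/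
theorem height_le_height_comap_C_add_one {A : Type*} [CommRing A] [IsNoetherianRing A]
    (P : Ideal A[X]) [hP : P.IsPrime] : P.height ≤ (P.comap C).height + 1 := by
  set p := P.comap C with hp
  have : p.IsPrime := Ideal.comap_isPrime C P
  have : P.LiesOver p := ⟨rfl⟩
  refine (Ideal.height_le_height_add_of_liesOver p P).trans ?_
  gcongr
  rw [Polynomial.algebraMap_eq]
  let e : (A[X] ⧸ (p.map (C : A →+* A[X]))) ≃+* (A ⧸ p)[X] :=
    (Ideal.polynomialQuotientEquivQuotientPolynomial p).symm
  have hle : p.map C ≤ P := Ideal.map_comap_le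
  have : (P.map (Ideal.Quotient.mk (p.map C))).IsPrime :=
    Ideal.map_isPrime_of_surjective Ideal.Quotient.mk_surjective (by rwa [Ideal.mk_ker])
  rw [← e.symm.height_comap]
  refine height_le_one_of_comap_C_eq_bot _ ?_
  rw [eq_bot_iff]
  intro a ha
  obtain ⟨a, rfl⟩ := Ideal.Quotient.mk_surjective a
  have he : e.symm (C (Ideal.Quotient.mk p a)) = Ideal.Quotient.mk (p.map C) (C a) := by
    have := Ideal.polynomialQuotientEquivQuotientPolynomial_map_mk p (C a)
    rwa [map_C] at this
  have ha' : e.symm (C (Ideal.Quotient.mk p a)) ∈ P.map (Ideal.Quotient.mk (p.map C)) := ha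
  rw [he, Ideal.mem_quotient_iff_mem hle] at ha'
  rw [Ideal.mem_bot, Ideal.Quotient.eq_zero_iff_mem]
  exact ha'

/-- The monic element makes `A[X] ⧸ I` integral over `A`, so a prime of least height over `I.comap
C` lifts to a prime containing `I`. -/
theorem height_le_height_comap_C_add_one_of_monic_mem {A : Type*} [CommRing A] [IsNoetherianRing A]
    {I : Ideal A[X]} {g : A[X]} (hg : g.Monic) (hgI : g ∈ I) :
    I.height ≤ (I.comap C).height + 1 := by
  by_cases htop : I.comap C = ⊤
  · rw [htop, Ideal.height_top]; simp
  obtain ⟨N, hN⟩ := ENat.ne_top_iff_exists.mp (Ideal.height_ne_top htop)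
  obtain ⟨p, _, hp, hpN⟩ := Ideal.exists_isPrime_height_eq hN.symm
  rw [← hN, ← hpN]
  have : Algebra.IsIntegral A (A[X] ⧸ I) := ⟨hg.quotient_isIntegral hgI⟩
  obtain ⟨Q, -, hQ, hQp⟩ :=
    Ideal.exists_ideal_over_prime_of_isIntegral p (⊥ : Ideal (A[X] ⧸ I)) (by
      refine le_trans (fun a ha => ?_) hp
      have ha' : Ideal.Quotient.mk I (C a) = 0 := ha
      rwa [Ideal.Quotient.eq_zero_iff_mem] at ha')
  have h1 : I ≤ Q.comap (Ideal.Quotient.mk I) := fun a ha => by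
    rw [Ideal.mem_comap, Ideal.Quotient.eq_zero_iff_mem.mpr ha]; exact zero_mem _
  refine (Ideal.height_mono h1).trans ((height_le_height_comap_C_add_one _).trans ?_)
  rw [Ideal.comap_comap]
  exact le_of_eq (congrArg (fun J : Ideal A => J.height + 1) hQp)

theorem Monic.mem_map_C_of_mul_mem {A : Type*} [CommRing A] {J : Ideal A} {g q : A[X]}
    (hg : g.Monic) (h : g * q ∈ J.map C) : q ∈ J.map C := by
  have key (a : A[X]) : a ∈ J.map C ↔ a.map (Ideal.Quotient.mk J) = 0 := by
    simp [Ideal.mem_map_C_iff, Polynomial.ext_iff, Ideal.Quotient.eq_zero_iff_mem]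
  rw [key, Polynomial.map_mul] at h
  rw [key]
  exact (hg.map (Ideal.Quotient.mk J)).mul_right_eq_zero_iff.mp h

theorem Monic.isWeaklyRegular_map_C_append {A : Type*} [CommRing A] {rs : List A} {g : A[X]}
    (hg : g.Monic) (h : IsWeaklyRegular A rs) : IsWeaklyRegular A[X] (rs.map C ++ [g]) := by
  rw [isWeaklyRegular_append_iff, isWeaklyRegular_singleton_iff]
  refine ⟨h.of_flat, ?_⟩
  rw [isSMulRegular_quotient_iff_mem_of_smul_mem]
  intro q hq
  rw [smul_eq_mul, Ideal.mul_top, ← Ideal.map_ofList] at hq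
  rw [smul_eq_mul, Ideal.mul_top, ← Ideal.map_ofList]
  exact hg.mem_map_C_of_mul_mem hq

end Polynomial

/-! ### Noether normalization and the Cohen–Macaulay property -/

namespace MvPolynomial

variable {k : Type*} [Field k] {n : ℕ}

/-- The automorphism `X₀ ↦ X₀`, `Xᵢ ↦ Xᵢ + X₀ ^ (N ^ i)` for `i ≠ 0`. -/
noncomputable def shearEquiv (k : Type*) [Field k] (n N : ℕ) :
    MvPolynomial (Fin (n + 1)) k ≃ₐ[k] MvPolynomial (Fin (n + 1)) k :=
  AlgEquiv.ofAlgHom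
    (aeval fun i => if i = 0 then X 0 else X i + X 0 ^ N ^ (i : ℕ))
    (aeval fun i => if i = 0 then X 0 else X i - X 0 ^ N ^ (i : ℕ))
    (by ext i : 1; cases i using Fin.cases <;> simp)
    (by ext i : 1; cases i using Fin.cases <;> simp)

theorem finSuccEquiv_shearEquiv_X {N : ℕ} (hN : N ≠ 0) (i : Fin (n + 1)) :
    (finSuccEquiv k n (shearEquiv k n N (X i))).Monic ∧
      (finSuccEquiv k n (shearEquiv k n N (X i))).natDegree = N ^ (i : ℕ) := by
  cases i using Fin.cases with
  | zero => simp [shearEquiv, finSuccEquiv_X_zero, Polynomial.monic_X]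
  | succ i =>
    have h : finSuccEquiv k n (shearEquiv k n N (X i.succ)) =
        Polynomial.X ^ N ^ ((i : ℕ) + 1) + Polynomial.C (X i) := by
      simp [shearEquiv, finSuccEquiv_X_zero, finSuccEquiv_X_succ, add_comm]
    rw [h]
    exact ⟨Polynomial.monic_X_pow_add_C _ (pow_ne_zero _ hN), by
      rw [Polynomial.natDegree_X_pow_add_C, Fin.val_succ]⟩

theorem exists_finSuccEquiv_shearEquiv_monomial {N : ℕ} (hN : N ≠ 0)
    (v : Fin (n + 1) →₀ ℕ) (a : k) :
    ∃ M : Polynomial (MvPolynomial (Fin n) k), M.Monic ∧ M.natDegree = ∑ i, v i * N ^ (i : ℕ) ∧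
      finSuccEquiv k n (shearEquiv k n N (monomial v a)) = Polynomial.C (C a) * M := by
  refine ⟨∏ i, finSuccEquiv k n (shearEquiv k n N (X i)) ^ v i,
    Polynomial.monic_prod_of_monic _ _ fun i _ => (finSuccEquiv_shearEquiv_X hN i).1.pow _, ?_, ?_⟩
  · rw [Polynomial.natDegree_prod_of_monic _ _
      fun i _ => (finSuccEquiv_shearEquiv_X hN i).1.pow _]
    refine Finset.sum_congr rfl fun i _ => ?_
    rw [(finSuccEquiv_shearEquiv_X hN i).1.natDegree_pow, (finSuccEquiv_shearEquiv_X hN i).2]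
  · rw [monomial_eq, Finsupp.prod_fintype _ _ (by simp)]
    simp only [map_mul, map_prod, map_pow]
    congr 1
    have := (finSuccEquiv k n).toAlgHom.comp (shearEquiv k n N).toAlgHom |>.commutes a
    exact this

/-- Uniqueness of base-`N` digits: distinct monomials acquire distinct degrees under the shear. -/
theorem sum_mul_pow_injective {N : ℕ} (hN : 1 < N) {v w : Fin (n + 1) →₀ ℕ}
    (hv : ∀ i, v i < N) (hw : ∀ i, w i < N)
    (h : ∑ i, v i * N ^ (i : ℕ) = ∑ i, w i * N ^ (i : ℕ)) : v = w := by
  refine Finsupp.ext <| congrFun <| List.ofFn_inj.mp ?_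
  refine Nat.ofDigits_inj_of_len_eq hN (by simp) ?_ ?_ ?_
  · exact List.forall_mem_ofFn_iff.mpr hv
  · exact List.forall_mem_ofFn_iff.mpr hw
  · simpa only [Nat.ofDigits_eq_sum_mapIdx, List.mapIdx_eq_ofFn, List.get_ofFn, List.length_ofFn,
      Fin.val_cast, mul_comm, List.sum_ofFn] using! h

/-- After an automorphism, a nonzero polynomial becomes monic in the first variable, up to a
scalar. -/
theorem exists_algEquiv_monic (f : MvPolynomial (Fin (n + 1)) k) (hf : f ≠ 0) :
    ∃ (e : MvPolynomial (Fin (n + 1)) k ≃ₐ[k] Polynomial (MvPolynomial (Fin n) k)) (c : k),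
      (e (c • f)).Monic := by
  -- `N` exceeds every exponent in `f`, and the summand 2 also makes it a valid base when `f` is
  -- constant.
  set N := 2 + f.totalDegree with hNdef
  let D (v : Fin (n + 1) →₀ ℕ) : ℕ := ∑ i, v i * N ^ (i : ℕ)
  have hlt : ∀ v ∈ f.support, ∀ i, v i < N := fun v hv i =>
    ((monomial_le_degreeOf i hv).trans (degreeOf_le_totalDegree f i)).trans_lt (by omega)
  obtain ⟨v, hv, hmax⟩ := Finset.exists_max_image f.support D (support_nonempty.mpr hf)
  obtain ⟨e, he⟩ : ∃ e : MvPolynomial (Fin (n + 1)) k ≃ₐ[k] Polynomial (MvPolynomial (Fin n) k),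
      ∀ v a, ∃ M : Polynomial (MvPolynomial (Fin n) k), M.Monic ∧ M.natDegree = D v ∧
        e (monomial v a) = Polynomial.C (C a) * M :=
    ⟨(shearEquiv k n N).trans (finSuccEquiv k n),
      exists_finSuccEquiv_shearEquiv_monomial (by omega)⟩
  have hfv : coeff v f ≠ 0 := mem_support_iff.mp hv
  choose M hM hMD hMe using fun u => he u ((coeff v f)⁻¹ * coeff u f)
  have he : e ((coeff v f)⁻¹ • f) =
      ∑ u ∈ f.support, Polynomial.C (C ((coeff v f)⁻¹ * coeff u f)) * M u := by
    conv_lhs => rw [← f.support_sum_monomial_coeff]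
    rw [Finset.smul_sum, map_sum]
    refine Finset.sum_congr rfl fun u _ => ?_
    rw [← hMe u, smul_monomial, smul_eq_mul, f.support_sum_monomial_coeff]
  refine ⟨e, (coeff v f)⁻¹, Polynomial.monic_of_natDegree_le_of_coeff_eq_one (D v) ?_ ?_⟩
  · rw [he]
    refine Polynomial.natDegree_sum_le_of_forall_le _ _ fun u hu => ?_
    exact (Polynomial.natDegree_C_mul_le _ _).trans ((hMD u).trans_le (hmax u hu))
  · rw [he, Polynomial.finsetSum_coeff, Finset.sum_eq_single_of_mem v hv]
    · rw [Polynomial.coeff_C_mul, show D v = (M v).natDegree from (hMD v).symm,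
        (hM v).coeff_natDegree, inv_mul_cancel₀ hfv]
      simp
    · intro u hu huv
      rw [Polynomial.coeff_C_mul, Polynomial.coeff_eq_zero_of_natDegree_lt, mul_zero]
      rw [hMD u]
      refine lt_of_le_of_ne (hmax u hu) fun h => huv ?_
      exact sum_mul_pow_injective (by omega) (hlt u hu) (hlt v hv) h

/-- Polynomial rings over a field are Cohen–Macaulay: a proper ideal of height at least `r`
contains a weakly regular sequence of length `r`. -/
theorem exists_isWeaklyRegular_of_le_height (I : Ideal (MvPolynomial (Fin n) k)) (hI : I ≠ ⊤)
    (r : ℕ) (hr : (r : ℕ∞) ≤ I.height) :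
    ∃ rs : List (MvPolynomial (Fin n) k), rs.length = r ∧ (∀ g ∈ rs, g ∈ I) ∧
      IsWeaklyRegular (MvPolynomial (Fin n) k) rs := by
  induction n generalizing r with
  | zero =>
    have hbot : I = ⊥ := by
      have : IsField (MvPolynomial (Fin 0) k) :=
        (isEmptyRingEquiv k (Fin 0)).toMulEquiv.isField (Field.toIsField k)
      let _ := this.toField
      exact (eq_bot_or_eq_top I).resolve_right hI
    rw [hbot, Ideal.height_bot] at hr
    obtain rfl : r = 0 := by simpa using hr
    exact ⟨[], rfl, by simp, IsWeaklyRegular.nil _ _⟩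
  | succ n ih =>
    cases r with
    | zero => exact ⟨[], rfl, by simp, IsWeaklyRegular.nil _ _⟩
    | succ r =>
      have hbot : I ≠ ⊥ := by
        rintro rfl
        rw [Ideal.height_bot] at hr
        simp at hr
      obtain ⟨f, hfI, hf⟩ := Submodule.exists_mem_ne_zero_of_ne_bot hbot
      obtain ⟨e, c, hmonic⟩ := exists_algEquiv_monic f hf
      let J : Ideal (Polynomial (MvPolynomial (Fin n) k)) := I.comap e.symm.toRingEquiv
      have hJ : ∀ p, p ∈ J ↔ e.symm p ∈ I := fun p => Iff.rfl
      have hgJ : e (c • f) ∈ J := by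
        rw [hJ, AlgEquiv.symm_apply_apply]
        exact Submodule.smul_of_tower_mem I c hfI
      have hht : J.height = I.height := RingEquiv.height_comap e.symm.toRingEquiv I
      have hJtop : J.comap Polynomial.C ≠ ⊤ := by
        rw [Ideal.ne_top_iff_one] at hI ⊢
        rwa [Ideal.mem_comap, map_one, hJ, map_one]
      -- Contracting to one variable fewer costs at most one in height; the monic element, appended
      -- last, makes up for it.
      have hle := Polynomial.height_le_height_comap_C_add_one_of_monic_mem hmonic hgJ
      obtain ⟨rs, hlen, hmem, hreg⟩ := ih (J.comap Polynomial.C) hJtop r (by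
        rw [hht] at hle
        have := hr.trans hle
        push_cast at this
        exact (ENat.add_le_add_iff_right ENat.one_ne_top).mp this)
      refine ⟨(rs.map Polynomial.C ++ [e (c • f)]).map e.symm, by simp [hlen], ?_, ?_⟩
      · intro g hg
        obtain ⟨p, hp, rfl⟩ := List.mem_map.mp hg
        rw [← hJ]
        rcases List.mem_append.mp hp with hp | hp
        · obtain ⟨q, hq, rfl⟩ := List.mem_map.mp hp
          exact hmem q hq
        · rwa [List.mem_singleton.mp hp]
      · refine (e.symm.toRingEquiv.toAddEquiv.isWeaklyRegular_congr ?_).mp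
          (hmonic.isWeaklyRegular_map_C_append hreg)
        exact List.forall₂_map_right_iff.mpr <| List.forall₂_same.mpr fun p _ x =>
          map_mul e.symm p x

end MvPolynomial

/-! ### Height of an ideal generated by a regular sequence -/

namespace RingTheory.Sequence.IsWeaklyRegular

variable {R : Type*} [CommRing R] {rs : List R}

theorem mem_of_mul_mem (h : IsWeaklyRegular R rs) {i : ℕ} (hi : i < rs.length) {x : R}
    (hx : rs[i] * x ∈ Ideal.ofList (rs.take i)) : x ∈ Ideal.ofList (rs.take i) := by
  have := (isSMulRegular_quotient_iff_mem_of_smul_mem _ _).mp (h.regular_mod_prev i hi) x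
  rw [smul_eq_mul, smul_eq_mul, Ideal.mul_top] at this
  exact this hx

theorem le_height_of_isPrime (h : IsWeaklyRegular R rs) {i : ℕ} (hi : i ≤ rs.length)
    (P : Ideal R) [P.IsPrime] (hP : Ideal.ofList (rs.take i) ≤ P) : (i : ℕ∞) ≤ P.height := by
  induction i generalizing P with
  | zero => simp
  | succ i ih =>
    have hi' : i < rs.length := hi
    rw [List.take_succ_eq_append_getElem hi', Ideal.ofList_append, Ideal.ofList_singleton] at hP
    obtain ⟨Q, hQ, hQP⟩ := Ideal.exists_minimalPrimes_le (le_sup_left.trans hP)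
    have := hQ.1.1
    have hlt : Q < P := by
      refine lt_of_le_of_ne hQP ?_
      rintro rfl
      -- An element of a minimal prime is a zero divisor modulo the radical; cancelling powers of
      -- `rs[i]` contradicts this.
      have hmem : rs[i] ∈ ⋃ p ∈ (Ideal.ofList (rs.take i)).minimalPrimes, (p : Set R) :=
        Set.mem_biUnion hQ (hP (Ideal.mem_sup_right (Ideal.mem_span_singleton_self _)))
      rw [Ideal.iUnion_minimalPrimes] at hmem
      obtain ⟨y, hy, m, hm⟩ := hmem
      refine hy ⟨m, ?_⟩
      rw [mul_pow] at hm
      have key (c : ℕ) (z : R) (hz : rs[i] ^ c * z ∈ Ideal.ofList (rs.take i)) :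
          z ∈ Ideal.ofList (rs.take i) := by
        induction c with
        | zero => simpa using hz
        | succ c ihc => exact ihc (h.mem_of_mul_mem hi' (by rwa [← mul_assoc, ← pow_succ']))
      exact key m _ hm
    push_cast
    exact (add_le_add_left (ih hi'.le Q hQ.1.2) 1).trans
      (Ideal.height_add_one_le_of_lt_of_isPrime hlt)

end RingTheory.Sequence.IsWeaklyRegular

/-- An ideal generated by a regular sequence has height equal to the length of the sequence. -/
theorem RingTheory.Sequence.IsRegular.height_ofList {R : Type*} [CommRing R] [IsNoetherianRing R]
    {rs : List R} (h : IsRegular R rs) : (Ideal.ofList rs).height = rs.length := by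
  have htop : Ideal.ofList rs ≠ ⊤ := by
    have := h.top_ne_smul
    rw [smul_eq_mul, Ideal.mul_top] at this
    exact this.symm
  refine le_antisymm ?_ ?_
  · obtain ⟨P, hP⟩ := Ideal.nonempty_minimalPrimes htop
    have := hP.1.1
    classical
    refine (Ideal.height_mono hP.1.2).trans
      ((Ideal.height_le_card_of_mem_minimalPrimes_span (List.finite_toSet rs) hP).trans ?_)
    have : {r | r ∈ rs} = (rs.toFinset : Set R) := by ext; simp
    rw [this, Set.ncard_coe_finset]
    exact_mod_cast rs.toFinset_card_le
  · rw [Ideal.height_eq_inf_minimalPrimes]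
    refine le_iInf₂ fun P hP => ?_
    have := hP.1.1
    exact h.le_height_of_isPrime le_rfl P (by rw [List.take_length]; exact hP.1.2)

theorem Ideal.ofList_ofFn {R : Type*} [CommRing R] {r : ℕ} (f : Fin r → R) :
    Ideal.ofList (List.ofFn f) = Ideal.span (Set.range f) := by
  exact congrArg Ideal.span (Set.ext fun x => List.mem_ofFn' f x)

theorem RingTheory.Sequence.isRegular_ofFn_iff {R : Type*} [CommRing R] {r : ℕ} (f : Fin r → R)
    (hf : Ideal.span (Set.range f) ≠ ⊤) :
    IsRegular R (List.ofFn f) ↔ IsWeaklyRegular R (List.ofFn f) := by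
  rw [isRegular_iff, smul_eq_mul, Ideal.mul_top, Ideal.ofList_ofFn]
  exact and_iff_left hf.symm

theorem RingTheory.Sequence.IsWeaklyRegular.take {R : Type*} [CommRing R] {rs : List R}
    (h : IsWeaklyRegular R rs) (i : ℕ) : IsWeaklyRegular R (rs.take i) := by
  rw [← List.take_append_drop i rs, isWeaklyRegular_append_iff] at h
  exact h.1

theorem List.ofFn_castLE {α : Type*} {t r : ℕ} (h : t ≤ r) (f : Fin r → α) :
    List.ofFn (fun i => f (Fin.castLE h i)) = (List.ofFn f).take t := by
  refine List.ext_getElem (by simp [h]) fun i h1 h2 => ?_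
  simp

/-! ### Trivial syzygies and graded Nakayama -/

/-- Every relation between the `f i` is a combination of the relations `f j * f i - f i * f j = 0`:
the first Koszul homology of `f` vanishes. -/
def OnlyTrivialSyzygies {R ι : Type*} [CommRing R] [Fintype ι] (f : ι → R) : Prop :=
  ∀ a : ι → R, ∑ i, a i * f i = 0 →
    ∃ b : ι → ι → R, ∀ i, a i = ∑ j, (b i j - b j i) * f j

namespace OnlyTrivialSyzygies

variable {R ι κ : Type*} [CommRing R] [Fintype ι] [Fintype κ]

theorem comp_equiv {f : ι → R} (h : OnlyTrivialSyzygies f) (e : κ ≃ ι) :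
    OnlyTrivialSyzygies (f ∘ e) := by
  intro a ha
  obtain ⟨b, hb⟩ := h (a ∘ e.symm) (by
    rw [← ha, ← Equiv.sum_comp e]; simp)
  refine ⟨fun i j => b (e i) (e j), fun i => ?_⟩
  have := hb (e i)
  rw [← Equiv.sum_comp e] at this
  simpa using this

/-- In the last entry of a trivial syzygy the diagonal term `b s s - b s s` cancels, leaving only
multiples of the earlier elements. -/
theorem mem_of_mul_mem {s : ℕ} {f : Fin (s + 1) → R} (h : OnlyTrivialSyzygies f) {x : R}
    (hx : f (Fin.last s) * x ∈ Ideal.span (Set.range fun i : Fin s => f i.castSucc)) :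
    x ∈ Ideal.span (Set.range fun i : Fin s => f i.castSucc) := by
  obtain ⟨c, hc⟩ := Ideal.mem_span_range_iff_exists_fun.mp hx
  obtain ⟨b, hb⟩ := h (Fin.snoc (fun i => - c i) x) (by
    rw [Fin.sum_univ_castSucc]
    simp only [Fin.snoc_castSucc, Fin.snoc_last, neg_mul, Finset.sum_neg_distrib, hc]
    ring)
  have := hb (Fin.last s)
  rw [Fin.snoc_last, Fin.sum_univ_castSucc, sub_self, zero_mul, add_zero] at this
  exact Ideal.mem_span_range_iff_exists_fun.mpr ⟨_, this.symm⟩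

/-- Syzygies of the initial part of `f` are trivial modulo any power of the last element. -/
theorem exists_eq_add_pow_mul {s : ℕ} {f : Fin (s + 1) → R} (h : OnlyTrivialSyzygies f) (m : ℕ)
    (a : Fin s → R) (ha : ∑ i, a i * f i.castSucc = 0) :
    ∃ (b : Fin s → Fin s → R) (y : Fin s → R), ∑ i, y i * f i.castSucc = 0 ∧
      ∀ i, a i = ∑ j, (b i j - b j i) * f j.castSucc + y i * f (Fin.last s) ^ m := by
  induction m with
  | zero => exact ⟨0, a, ha, by simp⟩
  | succ m ih =>
    obtain ⟨b, y, hy, hab⟩ := ih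
    -- Padded by 0, `y` is a syzygy of all of `f`. Its last entry being 0 is exactly the relation
    -- needed for the next `y`.
    obtain ⟨b', hb'⟩ := h (Fin.snoc y 0) (by
      rw [Fin.sum_univ_castSucc]; simpa using hy)
    refine ⟨fun i j => b i j + b' i.castSucc j.castSucc * f (Fin.last s) ^ m,
      fun i => b' i.castSucc (Fin.last s) - b' (Fin.last s) i.castSucc, ?_, fun i => ?_⟩
    · have := hb' (Fin.last s)
      rw [Fin.snoc_last, Fin.sum_univ_castSucc, sub_self, zero_mul, add_zero] at this
      rw [← neg_eq_zero, this, ← Finset.sum_neg_distrib]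
      exact Finset.sum_congr rfl fun i _ => by ring
    · have := hb' i.castSucc
      rw [Fin.snoc_castSucc, Fin.sum_univ_castSucc] at this
      rw [hab i, this, add_mul, Finset.sum_mul, ← add_assoc, ← Finset.sum_add_distrib]
      congr 1
      · exact Finset.sum_congr rfl fun j _ => by ring
      · ring

end OnlyTrivialSyzygies

namespace MvPolynomial

variable {k σ : Type*} [Field k] (w : σ → ℕ)

/-- The component of weighted degree `D - e`, which is zero if `D < e`. -/
noncomputable def shiftedComponent (D e : ℕ) : MvPolynomial σ k →ₗ[k] MvPolynomial σ k :=
  if e ≤ D then weightedHomogeneousComponent w (D - e) else 0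

theorem shiftedComponent_of_lt {D e : ℕ} (h : D < e) :
    (shiftedComponent w D e : MvPolynomial σ k →ₗ[k] MvPolynomial σ k) = 0 :=
  if_neg (not_le.mpr h)

/-- Setting components of negative degree to zero lets this hold with no comparison between `D` and
`e + m`. -/
theorem shiftedComponent_mul (D e : ℕ) {q : MvPolynomial σ k} {m : ℕ}
    (hq : IsWeightedHomogeneous w q m) (p : MvPolynomial σ k) :
    shiftedComponent w D e (p * q) = shiftedComponent w D (e + m) p * q := by
  have key (N : ℕ) : weightedHomogeneousComponent w N (p * q) =
      if m ≤ N then weightedHomogeneousComponent w (N - m) p * q else 0 := by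
    classical
    induction p using MvPolynomial.induction_on' with
    | monomial u a =>
      have hu : IsWeightedHomogeneous w (monomial u a) (Finsupp.weight w u) :=
        isWeightedHomogeneous_monomial w u a rfl
      rw [weightedHomogeneousComponent_of_mem (hu.mul hq), weightedHomogeneousComponent_of_mem hu]
      split_ifs <;> first | rfl | omega
    | add p p' hp hp' =>
      rw [add_mul, map_add, map_add, hp, hp']
      split_ifs
      · rw [add_mul]
      · rw [add_zero]
  unfold shiftedComponent
  split_ifs with h1 h2 h2
  · rw [key, if_pos (by omega), Nat.sub_sub]
  · rw [key, if_neg (by omega)]; simp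
  · omega
  · simp

theorem exists_sum_shiftedComponent_eq (e : ℕ) (p : MvPolynomial σ k) :
    ∃ N₀, ∀ N ≥ N₀, ∑ D ∈ Finset.range N, shiftedComponent w D e p = p := by
  refine ⟨e + (weightedTotalDegree w p + 1), fun N hN => ?_⟩
  obtain ⟨M, rfl⟩ := Nat.exists_eq_add_of_le (show e ≤ N by omega)
  rw [Finset.sum_range_add, Finset.sum_eq_zero, zero_add]
  · have (D : ℕ) : shiftedComponent w (e + D) e p = weightedHomogeneousComponent w D p := by
      simp [shiftedComponent]
    simp only [this]
    conv_rhs => rw [← sum_weightedHomogeneousComponent w p]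
    refine (finsum_eq_sum_of_support_subset _ fun D hD => ?_).symm
    rw [Finset.coe_range, Set.mem_Iio]
    by_contra hlt
    exact hD (weightedHomogeneousComponent_eq_zero _ _ (by omega))
  · intro D hD
    rw [Finset.mem_range] at hD
    rw [shiftedComponent_of_lt w hD, LinearMap.zero_apply]

end MvPolynomial

namespace OnlyTrivialSyzygies

variable {k σ : Type*} [Field k] {w : σ → ℕ}

open MvPolynomial

/-- Modulo a high power of the last element the syzygy is trivial. That power has large degree, so
taking the finitely many relevant components removes the error term. -/
theorem castSucc {s : ℕ} {f : Fin (s + 1) → MvPolynomial σ k} {d : Fin (s + 1) → ℕ}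
    (hd : ∀ i, 0 < d i) (hf : ∀ i, IsWeightedHomogeneous w (f i) (d i))
    (h : OnlyTrivialSyzygies f) : OnlyTrivialSyzygies fun i : Fin s => f i.castSucc := by
  intro a ha
  choose N hN using fun i : Fin s => exists_sum_shiftedComponent_eq w (d i.castSucc) (a i)
  let M := ∑ i, N i
  obtain ⟨b, y, -, hab⟩ := h.exists_eq_add_pow_mul M a ha
  refine ⟨fun i j => ∑ D ∈ Finset.range M,
    shiftedComponent w D (d i.castSucc + d j.castSucc) (b i j), fun i => ?_⟩
  rw [← hN i M (Finset.single_le_sum (fun _ _ => Nat.zero_le _) (Finset.mem_univ i))]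
  have key : ∀ D ∈ Finset.range M, shiftedComponent w D (d i.castSucc) (a i) =
      ∑ j, (shiftedComponent w D (d i.castSucc + d j.castSucc) (b i j) -
        shiftedComponent w D (d j.castSucc + d i.castSucc) (b j i)) * f j.castSucc := by
    intro D hD
    rw [Finset.mem_range] at hD
    rw [hab i, map_add, map_sum, shiftedComponent_mul w D _ ((hf (Fin.last s)).pow M)]
    -- Positivity of `d` enters here: the `M`-th power has degree at least `M > D`.
    have hlt : ¬ d i.castSucc + M • d (Fin.last s) ≤ D := by
      have := Nat.le_mul_of_pos_right M (hd (Fin.last s))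
      rw [smul_eq_mul]
      omega
    have hz : shiftedComponent w D (d i.castSucc + M • d (Fin.last s)) (y i) = 0 := by
      rw [shiftedComponent_of_lt w (not_le.mp hlt), LinearMap.zero_apply]
    rw [hz, zero_mul, add_zero]
    refine Finset.sum_congr rfl fun j _ => ?_
    rw [shiftedComponent_mul w D _ (hf j.castSucc), map_sub, add_comm (d j.castSucc)]
  rw [Finset.sum_congr rfl key, Finset.sum_comm]
  refine Finset.sum_congr rfl fun j _ => ?_
  rw [← Finset.sum_mul, Finset.sum_sub_distrib]

theorem isWeaklyRegular {s : ℕ} {f : Fin s → MvPolynomial σ k} {d : Fin s → ℕ}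
    (hd : ∀ i, 0 < d i) (hf : ∀ i, IsWeightedHomogeneous w (f i) (d i))
    (h : OnlyTrivialSyzygies f) : IsWeaklyRegular (MvPolynomial σ k) (List.ofFn f) := by
  induction s with
  | zero => rw [List.ofFn_zero]; exact IsWeaklyRegular.nil _ _
  | succ s ih =>
    rw [List.ofFn_succ_last, isWeaklyRegular_append_iff, isWeaklyRegular_singleton_iff,
      isSMulRegular_quotient_iff_mem_of_smul_mem]
    refine ⟨ih (fun i => hd i.castSucc) (fun i => hf i.castSucc) (h.castSucc hd hf), ?_⟩
    intro x hx
    rw [smul_eq_mul, Ideal.mul_top, Ideal.ofList_ofFn] at hx ⊢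
    exact h.mem_of_mul_mem hx

end OnlyTrivialSyzygies

/-! ### From first Koszul homology to syzygies -/

namespace KoszulCx

theorem onlyTrivialSyzygies {R : Type*} [CommRing R] {r : ℕ} (f : Fin r → R)
    (h : ∀ x, diffDeg f 0 x = 0 → ∃ z, diffDeg f 1 z = x) : OnlyTrivialSyzygies f := by
  intro a ha
  have hι (m : Fin r → R) : diff f (ExteriorAlgebra.ι R m) =
      algebraMap R _ (Fintype.linearCombination R f m) := by
    have := diff_ι_mul f m 1
    rwa [mul_one, diff_one, mul_zero, sub_zero, ← Algebra.algebraMap_eq_smul_one] at this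
  obtain ⟨⟨z, hz⟩, hza⟩ := h ⟨ExteriorAlgebra.ι R a, by
    change _ ∈ LinearMap.range (ExteriorAlgebra.ι R) ^ 1
    rw [pow_one]; exact LinearMap.mem_range_self _ a⟩ (Subtype.ext (by
      change diff f (ExteriorAlgebra.ι R a) = 0
      rw [hι, Fintype.linearCombination_apply]
      simp only [smul_eq_mul, ha, map_zero]))
  replace hza : diff f z = ExteriorAlgebra.ι R a := congrArg Subtype.val hza
  have key : ∃ b : Fin r → Fin r → R, diff f z =
      ExteriorAlgebra.ι R fun i => ∑ j, (b i j - b j i) * f j := by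
    clear hza
    change z ∈ LinearMap.range (ExteriorAlgebra.ι R) ^ 2 at hz
    rw [pow_two] at hz
    induction hz using Submodule.mul_induction_on' with
    | mem_mul_mem x hx y hy =>
      obtain ⟨m, rfl⟩ := hx
      obtain ⟨m', rfl⟩ := hy
      -- These are the coordinates of `d (m ∧ m') = f(m) m' - f(m') m`.
      refine ⟨fun i j => m' i * m j, ?_⟩
      rw [diff_ι_mul, hι, ← Algebra.commutes, ← Algebra.smul_def, ← map_smul, ← map_smul,
        ← map_sub]
      congr 1
      ext i
      simp only [Fintype.linearCombination_apply, Pi.sub_apply, Pi.smul_apply, smul_eq_mul,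
        Finset.sum_mul, ← Finset.sum_sub_distrib]
      exact Finset.sum_congr rfl fun j _ => by ring
    | add x _ y _ hx hy =>
      obtain ⟨b, hb⟩ := hx
      obtain ⟨b', hb'⟩ := hy
      refine ⟨b + b', ?_⟩
      rw [map_add, hb, hb', ← map_add]
      congr 1
      ext i
      simp only [Pi.add_apply, ← Finset.sum_add_distrib]
      exact Finset.sum_congr rfl fun j _ => by ring
  obtain ⟨b, hb⟩ := key
  exact ⟨b, fun i => congrFun ((ExteriorAlgebra.ι_inj R _ _).mp (hza.symm.trans hb)) i⟩

end KoszulCx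

/-! ### Properness, permutations and the main theorem -/

theorem MvPolynomial.span_range_ne_top_of_isWeightedHomogeneous {k σ ι : Type*} [Field k]
    {w : σ → ℕ} {f : ι → MvPolynomial σ k} {d : ι → ℕ} (hd : ∀ i, 0 < d i)
    (hf : ∀ i, IsWeightedHomogeneous w (f i) (d i)) : Ideal.span (Set.range f) ≠ ⊤ := by
  have hle : Ideal.span (Set.range f) ≤ RingHom.ker (constantCoeff : MvPolynomial σ k →+* k) := by
    rw [Ideal.span_le]
    rintro _ ⟨i, rfl⟩
    exact (hf i).coeff_eq_zero 0 (by simpa using (hd i).ne)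
  exact ne_top_of_le_ne_top (RingHom.ker_ne_top _) hle

/-- An injection between finite initial segments extends to a permutation. -/
theorem Fin.exists_perm_castLE_eq {t r : ℕ} (h : t ≤ r) (σ : Fin t ↪ Fin r) :
    ∃ e : Equiv.Perm (Fin r), ∀ i, e (Fin.castLE h i) = σ i := by
  obtain ⟨e, he⟩ := Set.MapsTo.exists_equiv_extend_of_card_eq (α := Fin r) (t := Finset.univ)
    (s := Set.range (Fin.castLE h)) (f := fun j => if hj : (j : ℕ) < t then σ ⟨j, hj⟩ else j)
    (by simp) (fun _ _ => by simp) (by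
      rintro _ ⟨i, rfl⟩ _ ⟨j, rfl⟩ hij
      simpa using hij)
  refine ⟨e.trans (Equiv.subtypeUnivEquiv (by simp)), fun i => ?_⟩
  have := he _ ⟨i, rfl⟩
  simpa using this

theorem mainTheorem5 {k : Type*} [Field k] (n r : ℕ)
    (w : Fin n → ℕ) (f : Fin r → MvPolynomial (Fin n) k) (d : Fin r → ℕ)
    (hd : ∀ i, 0 < d i)
    (hf : ∀ i, MvPolynomial.IsWeightedHomogeneous w (f i) (d i)) :
    List.TFAE [
      RingTheory.Sequence.IsRegular (MvPolynomial (Fin n) k) (List.ofFn f),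
      ∀ j : ℕ, 1 ≤ j → j ≤ r →
        (Ideal.span {p | ∃ i : Fin r, i.val < j ∧ f i = p}).height = (j : ℕ∞),
      (Ideal.span (Set.range f)).height = (r : ℕ∞),
      ∀ j : ℕ, 1 ≤ j → j ≤ r → CategoryTheory.Limits.IsZero ((KoszulCx.koszul f).homology j),
      CategoryTheory.Limits.IsZero ((KoszulCx.koszul f).homology 1)] ∧
    (RingTheory.Sequence.IsRegular (MvPolynomial (Fin n) k) (List.ofFn f) →
      ∀ (t : ℕ) (σ : Fin t ↪ Fin r),
        RingTheory.Sequence.IsRegular (MvPolynomial (Fin n) k)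
          (List.ofFn fun i => f (σ i))) := by
  have htop := MvPolynomial.span_range_ne_top_of_isWeightedHomogeneous hd hf
  refine ⟨?_, fun hreg t σ => ?_⟩
  · tfae_have 1 → 2 := by
      intro h j _ hj
      have hset : {p | ∃ i : Fin r, i.val < j ∧ f i = p} =
          Set.range fun i : Fin j => f (Fin.castLE hj i) := by
        ext p
        constructor
        · rintro ⟨i, hi, rfl⟩
          exact ⟨⟨i, hi⟩, rfl⟩
        · rintro ⟨i, rfl⟩
          exact ⟨Fin.castLE hj i, i.2, rfl⟩
      have hreg : IsRegular (MvPolynomial (Fin n) k)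
          (List.ofFn fun i : Fin j => f (Fin.castLE hj i)) := by
        rw [isRegular_ofFn_iff _ (MvPolynomial.span_range_ne_top_of_isWeightedHomogeneous
          (fun i => hd _) fun i => hf _), List.ofFn_castLE hj]
        exact h.toIsWeaklyRegular.take j
      rw [hset, ← Ideal.ofList_ofFn, hreg.height_ofList, List.length_ofFn]
    tfae_have 2 → 3 := by
      intro h
      rcases Nat.eq_zero_or_pos r with rfl | hr
      · simp [Set.range_eq_empty f]
      · have := h r hr le_rfl
        simpa [Set.range] using this
    tfae_have 3 → 4 := by
      rintro h (_ | j) hj _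
      · omega
      obtain ⟨rs, hlen, hmem, hreg⟩ :=
        MvPolynomial.exists_isWeaklyRegular_of_le_height _ htop r h.ge
      exact (KoszulCx.isZero_homology_iff f j).mpr
        (KoszulCx.exists_diffDeg_eq f hlen.ge hreg hmem j)
    tfae_have 4 → 5 := by
      intro h
      rcases Nat.eq_zero_or_pos r with rfl | hr
      -- For `r = 0` condition 4 is vacuous, but `⋀¹` is already zero.
      · refine (KoszulCx.isZero_homology_iff f 0).mpr fun x _ => ⟨0, ?_⟩
        exact (KoszulCx.subsingleton_exteriorPower_of_lt Nat.one_pos).elim _ _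
      · exact h 1 le_rfl hr
    tfae_have 5 → 1 := by
      intro h
      rw [isRegular_ofFn_iff f htop]
      exact (KoszulCx.onlyTrivialSyzygies f
        ((KoszulCx.isZero_homology_iff f 0).mp h)).isWeaklyRegular hd hf
    tfae_finish
  · have ht : t ≤ r := by simpa using Fintype.card_le_of_embedding σ
    obtain ⟨e, he⟩ := Fin.exists_perm_castLE_eq ht σ
    -- The sequence `f` itself serves as the weakly regular sequence in its ideal; its trivial
    -- syzygies survive the permutation `e`, which moves the chosen subsequence to the front.
    have hsyz := KoszulCx.onlyTrivialSyzygies f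
      (KoszulCx.exists_diffDeg_eq f (by simp) hreg.toIsWeaklyRegular
        (fun g hg => Ideal.subset_span ((List.mem_ofFn' f g).mp hg)) 0)
    have hw := ((hsyz.comp_equiv e).isWeaklyRegular (fun i => hd (e i)) fun i => hf (e i)).take t
    rw [← List.ofFn_castLE ht] at hw
    rw [isRegular_ofFn_iff _ (MvPolynomial.span_range_ne_top_of_isWeightedHomogeneous
      (fun i => hd (σ i)) fun i => hf (σ i))]
    simpa only [Function.comp_apply, he] using hw
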